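/- Let $d\ge 1$, and let $A_n, B_n$ $(n=1,2,\dots)$ be complex $d\times d$ matrices with $B_n=B_n^*$ and $A_n$ invertible for all $n$. Let $J$ be any self-adjoint extension in $\ell^2(\mathbb N;\mathbb C^d)$ of the block Jacobi operator $$(Ju)_1=B_1u_1+A_1u_2,\qquad (Ju)_n=A_{n-1}^*u_{n-1}+B_nu_n+A_nu_{n+1}\quad (n\ge 2),$$ defined on finitely supported sequences $u=(u_1,u_2,\dots)$. For a Hermitian matrix $B$ with positive part $B_+$, let $(B^{-1})_\oplus$ be the matrix equal to $(B_+)^{-1}$ on $\operatorname{Im}(B_+)$ and to $0$ on $\operatorname{Im}(B_+)^\perp$, and let $(B^{-1/2})_\oplus=\big((B^{-1})_\oplus\big)^{1/2}$ be its nonnegative square root. Assume that: 1. $\lim_{k\to\infty}B_{2k-1}=+\infty$, i.e. for every $M\ge 0$ one has $B_{2k-1}\ge M I$ for all sufficiently large $k$; 2. $\lim_{k\to\infty}(B_{2k}^{-1})_\oplus=0$, i.e. for every $M\ge 0$ all positive eigenvalues of $B_{2k}$ (if there are any) are at least $M$ for all sufficiently large $k$; 3. with the operator norm on $\mathbb C^d$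 and upper limits in $[0,+\infty]$ (the matrices $B_{2n-1}$ being positive definite for large $n$ by 1), $$\limsup_{n\to\infty}\big\|(B_{2n}^{-1/2})_\oplus A_{2n-1}^*B_{2n-1}^{-1/2}\big\|+\limsup_{n\to\infty}\big\|(B_{2n-2}^{-1/2})_\oplus A_{2n-2}B_{2n-1}^{-1/2}\big\|<1.$$ Then $\sigma(J)\cap(0,+\infty)$ is discrete: every point of $\sigma(J)\cap(0,+\infty)$ is an isolated point of $\sigma(J)$ and an eigenvalue of $J$ of finite multiplicity. -/

import Mathlib

open Filter Topology
open scoped ENNReal Matrix ComplexOrder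

noncomputable section

namespace BlockJacobi

/-- Square complex matrices of size `d`. -/
abbrev Mat (d : ℕ) : Type := Matrix (Fin d) (Fin d) ℂ

/-- The Hilbert space `ℓ²(ℕ; ℂᵈ)`. Sequences are indexed from `0`, so the coordinate `u j`
is the `(j + 1)`-st component of a sequence `(u₁, u₂, …)`. -/
abbrev L2 (d : ℕ) : Type := lp (fun _ : ℕ => EuclideanSpace ℂ (Fin d)) 2

/-- The operator on the Euclidean space `ℂᵈ` given by a matrix; the norm of `op M` is the
operator norm. -/
abbrev op {d : ℕ} (M : Mat d) : EuclideanSpace ℂ (Fin d) →L[ℂ] EuclideanSpace ℂ (Fin d) :=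
  Matrix.toEuclideanCLM (n := Fin d) (𝕜 := ℂ) M

/-- `B n → +∞`: for every `M ≥ 0` one has `B n ≥ M I` for all large `n`. -/
def TendsToInfty {d : ℕ} (B : ℕ → Mat d) : Prop :=
  ∀ M : ℝ, 0 ≤ M → ∃ N : ℕ, ∀ n ≥ N, (B n - (M : ℂ) • (1 : Mat d)).PosSemidef

/-- For Hermitian `B`, the matrix which is the inverse of the positive part `B₊` on the range of
`B₊` and is zero on the orthogonal complement of this range. -/
def posInv {d : ℕ} (B : Mat d) : Mat d := cfc (fun x : ℝ => if 0 < x then x⁻¹ else 0) B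

/-- The nonnegative square root of `posInv B`. -/
def posInvSqrt {d : ℕ} (B : Mat d) : Mat d := cfc Real.sqrt (posInv B)

/-- The inverse square root `B ^ (-1/2)` of a positive definite matrix `B`. -/
def invSqrt {d : ℕ} (B : Mat d) : Mat d := cfc (fun x : ℝ => x ^ (-(1 / 2) : ℝ)) B

/-- The formal action of the block Jacobi matrix with diagonal blocks `B 0, B 1, …`, blocks
`A 0, A 1, …` above the diagonal and `(A 0)ᴴ, (A 1)ᴴ, …` below it, on an arbitrary sequence. -/
def formal {d : ℕ} (A B : ℕ → Mat d) (u : ℕ → EuclideanSpace ℂ (Fin d)) :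
    ℕ → EuclideanSpace ℂ (Fin d)
  | 0 => op (B 0) (u 0) + op (A 0) (u 1)
  | j + 1 => op (A j)ᴴ (u j) + op (B (j + 1)) (u (j + 1)) + op (A (j + 1)) (u (j + 2))

theorem formal_add {d : ℕ} (A B : ℕ → Mat d) (u v : ℕ → EuclideanSpace ℂ (Fin d)) :
    formal A B (u + v) = formal A B u + formal A B v := by
  funext j
  cases j <;> simp only [formal, Pi.add_apply, map_add] <;> abel

theorem formal_smul {d : ℕ} (A B : ℕ → Mat d) (c : ℂ) (u : ℕ → EuclideanSpace ℂ (Fin d)) :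
    formal A B (c • u) = c • formal A B u := by
  funext j
  cases j <;> simp only [formal, Pi.smul_apply, map_smul, smul_add]

/-- The subspace of finitely supported sequences. -/
def finSupp (d : ℕ) : Submodule ℂ (L2 d) where
  carrier := {u | ∃ N : ℕ, ∀ j ≥ N, u j = 0}
  zero_mem' := ⟨0, fun _ _ => rfl⟩
  add_mem' := by
    rintro u v ⟨N, hN⟩ ⟨M, hM⟩
    refine ⟨max N M, fun j hj => ?_⟩
    have h : (u + v) j = u j + v j := rfl
    rw [h, hN j (le_trans (le_max_left _ _) hj), hM j (le_trans (le_max_right _ _) hj), add_zero]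
  smul_mem' := by
    rintro c u ⟨N, hN⟩
    refine ⟨N, fun j hj => ?_⟩
    have h : (c • u) j = c • u j := rfl
    rw [h, hN j hj, smul_zero]

theorem memℓp_formal {d : ℕ} (A B : ℕ → Mat d) (u : finSupp d) :
    Memℓp (formal A B (u : L2 d)) 2 := by
  obtain ⟨N, hN⟩ := u.2
  refine (memℓp_zero ((Set.finite_Iio (N + 1)).subset fun j hj => ?_)).of_exponent_ge zero_le
  by_contra hlt
  simp only [Set.mem_Iio, not_lt] at hlt
  apply hj
  obtain ⟨i, rfl⟩ : ∃ i, j = i + 1 := ⟨j - 1, by omega⟩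
  simp [formal, hN i (by omega), hN (i + 1) (by omega), hN (i + 2) (by omega)]

/-- The minimal operator: the Jacobi matrix on finitely supported sequences. -/
def minimal {d : ℕ} (A B : ℕ → Mat d) : L2 d →ₗ.[ℂ] L2 d where
  domain := finSupp d
  toFun :=
    { toFun := fun u => ⟨formal A B (u : L2 d), memℓp_formal A B u⟩
      map_add' := fun u v => Subtype.ext (formal_add A B (u : L2 d) (v : L2 d))
      map_smul' := fun c u => Subtype.ext (formal_smul A B c (u : L2 d)) }

/-- `z` lies in the resolvent set of `T`: the operator `T - z` maps the domain of `T` bijectively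
onto the whole space, with bounded inverse `R`. -/
def IsResolventPoint {H : Type*} [NormedAddCommGroup H] [NormedSpace ℂ H]
    (T : H →ₗ.[ℂ] H) (z : ℂ) : Prop :=
  ∃ R : H →L[ℂ] H, (∀ x : T.domain, R (T x - z • (x : H)) = x) ∧
    ∀ y : H, ∃ x : T.domain, (x : H) = R y ∧ T x - z • (x : H) = y

/-- The spectrum of an unbounded operator. -/
def spec {H : Type*} [NormedAddCommGroup H] [NormedSpace ℂ H] (T : H →ₗ.[ℂ] H) : Set ℂ :=
  {z | ¬ IsResolventPoint T z}

/-- The kernel of `T - z`, as a subspace of the domain of `T`. -/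
def eigenspace {H : Type*} [NormedAddCommGroup H] [NormedSpace ℂ H]
    (T : H →ₗ.[ℂ] H) (z : ℂ) : Submodule ℂ T.domain :=
  LinearMap.ker (T.toFun - z • T.domain.subtype)

/-- The spectrum of `T` in the set `I` of real numbers is discrete: each of its points is an
isolated point of the spectrum of `T` and an eigenvalue of finite multiplicity. -/
def DiscreteSpectrumOn {H : Type*} [NormedAddCommGroup H] [NormedSpace ℂ H]
    (T : H →ₗ.[ℂ] H) (I : Set ℝ) : Prop :=
  ∀ t ∈ I, (t : ℂ) ∈ spec T →
    (∃ U ∈ 𝓝 (t : ℂ), spec T ∩ U = {(t : ℂ)}) ∧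
      eigenspace T (t : ℂ) ≠ ⊥ ∧ FiniteDimensional ℂ (eigenspace T (t : ℂ))

end BlockJacobi

end

/-! Fix t > 0 and let S be the block diagonal unitary with blocks `sgn (B j)`: 1 on the positive
spectral subspace of `B j` and -1 on its complement. For finitely supported u vanishing before a
large site m, the form Re⟨(J - t)u, Su⟩ is at least t‖u‖², whence ‖(J - t)u‖ ≥ t‖u‖
(`mul_norm_le_norm_shifted`). On the diagonal, ⟨Bu, Su⟩ is the form of |B|, while -t⟨u, Su⟩ = t‖u‖²
- 2t‖Eu‖², with E the positive spectral projection. Positive eigenvalues far out are large, so the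
loss 2t‖Eu‖² costs only a small part of the form of B₊. Every link joins an even site, where B > 0,
to an odd one, so the parts of its two cross terms involving the negative subspace cancel
(`re_inner_link_le`). What remains is bounded by the norms in the limsup condition; a site meets two
links, so the sum of the two limits being below 1 lets B₊ absorb both. A vector orthogonal to the
image under J - t of these u solves the eigenvalue recursion from m on. Since the `A j` are
invertible, such solutions form a finite-dimensional space. The range of J - t therefore contains a
closed subspace of finite codimension and is closed (`isClosed_range_shifted`); the kernel is
finite-dimensional for the same reason. For a self-adjoint operator this makes a spectral point t an
isolated eigenvalue (`isolated_of_isClosed_range`). Finitely supported sequences need not be a core,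
so the argument covers every self-adjoint extension. -/

/-! ### Self-adjoint operators: closed range and isolated spectral points. -/

section SelfAdjoint

variable {H : Type*} [NormedAddCommGroup H] [InnerProductSpace ℂ H] [CompleteSpace H]

/-- A self-adjoint operator is symmetric. -/
theorem IsSelfAdjoint.inner_linearPMap {T : H →ₗ.[ℂ] H} (hT : IsSelfAdjoint T)
    (x y : T.domain) : inner ℂ (T x) (y : H) = inner ℂ (x : H) (T y) := by
  have h := LinearPMap.adjoint_isFormalAdjoint hT.dense_domain
  rw [LinearPMap.isSelfAdjoint_def.mp hT] at h
  exact h x y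

/-- A pair that satisfies the symmetry relation against the whole domain of a self-adjoint
operator belongs to its graph. -/
theorem IsSelfAdjoint.exists_of_inner_linearPMap {T : H →ₗ.[ℂ] H} (hT : IsSelfAdjoint T)
    (v w : H) (h : ∀ x : T.domain, inner ℂ w (x : H) = inner ℂ v (T x)) :
    ∃ y : T.domain, (y : H) = v ∧ T y = w := by
  have hv : (v, w) ∈ T.graph := by
    have hmem := LinearPMap.mem_adjoint_domain_of_exists (T := T) v ⟨w, h⟩
    have hw := LinearPMap.adjoint_apply_eq hT.dense_domain ⟨v, hmem⟩ h
    have := LinearPMap.mem_graph T.adjoint ⟨v, hmem⟩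
    rw [hw] at this
    have hTg : T.adjoint.graph = T.graph := congrArg _ (LinearPMap.isSelfAdjoint_def.mp hT)
    exact hTg ▸ this
  simpa [LinearPMap.mem_graph_iff] using hv

/-- A limit of points of the graph of a self-adjoint operator is in the graph. -/
theorem IsSelfAdjoint.exists_of_tendsto {T : H →ₗ.[ℂ] H} (hT : IsSelfAdjoint T)
    {x : ℕ → T.domain} {v w : H} (hv : Tendsto (fun n => (x n : H)) atTop (𝓝 v))
    (hw : Tendsto (fun n => T (x n)) atTop (𝓝 w)) :
    ∃ y : T.domain, (y : H) = v ∧ T y = w := by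
  have hmem : (v, w) ∈ T.graph :=
    IsClosed.mem_of_tendsto (show IsClosed (T.graph : Set (H × H)) from hT.isClosed)
      (hv.prodMk_nhds hw) (Eventually.of_forall fun n => LinearPMap.mem_graph T (x n))
  simpa [LinearPMap.mem_graph_iff] using hmem

namespace BlockJacobi

/-- The operator `T - z` on the domain of `T`. -/
def shifted {E : Type*} [NormedAddCommGroup E] [NormedSpace ℂ E] (T : E →ₗ.[ℂ] E) (z : ℂ) :
    T.domain →ₗ[ℂ] E :=
  T.toFun - z • T.domain.subtype

theorem shifted_apply {E : Type*} [NormedAddCommGroup E] [NormedSpace ℂ E] (T : E →ₗ.[ℂ] E)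
    (z : ℂ) (x : T.domain) : shifted T z x = T x - z • (x : E) := rfl

/-- The image under `T - z` of a subspace of the domain on which `T - z` is bounded below has its
closure in the range of `T - z`. -/
theorem topologicalClosure_map_shifted_le {T : H →ₗ.[ℂ] H} (hT : IsSelfAdjoint T) (z : ℂ) {c : ℝ}
    (hc : 0 < c) (V : Submodule ℂ T.domain) (hV : ∀ x ∈ V, c * ‖(x : H)‖ ≤ ‖shifted T z x‖) :
    (V.map (shifted T z)).topologicalClosure ≤ LinearMap.range (shifted T z) := by
  intro w hw
  obtain ⟨s, hs, hlim⟩ := mem_closure_iff_seq_limit.mp hw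
  choose x hxV hx using hs
  have hcauchy : CauchySeq fun n => (x n : H) := by
    rw [Metric.cauchySeq_iff']
    intro ε hε
    obtain ⟨N, hN⟩ := Metric.cauchySeq_iff'.mp hlim.cauchySeq (c * ε) (by positivity)
    refine ⟨N, fun n hn => ?_⟩
    have h1 := hV (x n - x N) (V.sub_mem (hxV n) (hxV N))
    have h2 := hN n hn
    rw [dist_eq_norm] at h2 ⊢
    rw [map_sub, hx, hx] at h1
    exact lt_of_mul_lt_mul_left (h1.trans_lt h2) hc.le
  obtain ⟨v, hv⟩ := cauchySeq_tendsto_of_complete hcauchy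
  have hTx : Tendsto (fun n => T (x n)) atTop (𝓝 (w + z • v)) := by
    refine (hlim.add (hv.const_smul z)).congr fun n => ?_
    rw [← hx n, shifted_apply]
    abel
  obtain ⟨y, rfl, hy⟩ := hT.exists_of_tendsto hv hTx
  exact ⟨y, by rw [shifted_apply, hy]; abel⟩

/-- If `T` is self-adjoint and `T - z`, `T - conj z` are bounded below, then `z` is in the
resolvent set. -/
theorem isResolventPoint_of_bound {T : H →ₗ.[ℂ] H} (hT : IsSelfAdjoint T) (z : ℂ) {c : ℝ}
    (hc : 0 < c) (hz : ∀ x : T.domain, c * ‖(x : H)‖ ≤ ‖shifted T z x‖)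
    (hz' : ∀ x : T.domain, c * ‖(x : H)‖ ≤ ‖shifted T (starRingEnd ℂ z) x‖) :
    IsResolventPoint T z := by
  have hcl := topologicalClosure_map_shifted_le hT z hc ⊤ fun x _ => hz x
  rw [Submodule.map_top] at hcl
  have htop : LinearMap.range (shifted T z) = ⊤ := by
    refine top_le_iff.mp (le_trans (le_of_eq ?_) hcl)
    symm
    rw [Submodule.topologicalClosure_eq_top_iff, Submodule.eq_bot_iff]
    intro v hv
    rw [Submodule.mem_orthogonal'] at hv
    -- Orthogonality to the range of T - z puts v in the domain of T* = T with Tv = conj z • v; the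
    -- bound at conj z then forces v = 0.
    obtain ⟨y, rfl, hy⟩ := hT.exists_of_inner_linearPMap v (starRingEnd ℂ z • v) fun x => by
      have := hv _ ⟨x, rfl⟩
      rw [shifted_apply, inner_sub_right, sub_eq_zero, inner_smul_right] at this
      rw [inner_smul_left, this, Complex.conj_conj]
    have h0 := hz' y
    rw [shifted_apply, hy, sub_self, norm_zero] at h0
    exact norm_eq_zero.mp (le_antisymm (by nlinarith [norm_nonneg (y : H)]) (norm_nonneg _))
  have hinj : LinearMap.ker (shifted T z) = ⊥ := by
    refine LinearMap.ker_eq_bot'.mpr fun x hx => ?_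
    have h0 := hz x
    rw [hx, norm_zero] at h0
    exact Subtype.ext (norm_eq_zero.mp
      (le_antisymm (by nlinarith [norm_nonneg (x : H)]) (norm_nonneg _)))
  let e : T.domain ≃ₗ[ℂ] H :=
    LinearEquiv.ofBijective (shifted T z) ⟨LinearMap.ker_eq_bot.mp hinj, LinearMap.range_eq_top.mp htop⟩
  have he : ∀ x, e x = shifted T z x := fun _ => rfl
  refine ⟨LinearMap.mkContinuous (T.domain.subtype ∘ₗ e.symm.toLinearMap) c⁻¹ fun y => ?_,
    fun x => ?_, fun y => ⟨e.symm y, rfl, ?_⟩⟩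
  · have h := hz (e.symm y)
    rw [← he, e.apply_symm_apply] at h
    rw [inv_mul_eq_div, le_div_iff₀ hc, mul_comm]
    exact h
  · change ((e.symm (shifted T z x) : T.domain) : H) = x
    rw [← he, e.symm_apply_apply]
  · rw [← shifted_apply, ← he, e.apply_symm_apply]

/-- If the range of `T - z` is closed, then `T - z` is bounded below on the part of the domain
orthogonal to its kernel. -/
theorem exists_bound_of_isClosed_range {T : H →ₗ.[ℂ] H} (hT : IsSelfAdjoint T) (z : ℂ)
    (hR : IsClosed (LinearMap.range (shifted T z) : Set H)) :
    ∃ c : ℝ, 0 < c ∧ ∀ x : T.domain,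
      (∀ y : T.domain, shifted T z y = 0 → inner ℂ (y : H) (x : H) = 0) →
        c * ‖(x : H)‖ ≤ ‖shifted T z x‖ := by
  have hG : IsClosed (T.graph : Set (H × H)) := hT.isClosed
  have : CompleteSpace T.graph := hG.completeSpace_coe
  have : CompleteSpace (LinearMap.range (shifted T z)) := hR.completeSpace_coe
  -- The closed graph is a Banach space on which T - z is continuous, so the open mapping theorem
  -- yields preimages of controlled norm.
  let S : T.graph →L[ℂ] H :=
    (ContinuousLinearMap.snd ℂ H H - z • ContinuousLinearMap.fst ℂ H H) ∘L T.graph.subtypeL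
  have hSmem : ∀ p : T.graph, S p ∈ LinearMap.range (shifted T z) := by
    rintro ⟨⟨a, b⟩, hp⟩
    obtain ⟨y, rfl, rfl⟩ : ∃ y : T.domain, (y : H) = a ∧ T y = b := by
      simpa [LinearPMap.mem_graph_iff] using hp
    exact ⟨y, rfl⟩
  let S' : T.graph →L[ℂ] LinearMap.range (shifted T z) := S.codRestrict _ hSmem
  have hsurj : Function.Surjective S' := by
    rintro ⟨_, y, rfl⟩
    exact ⟨⟨(y, T y), LinearPMap.mem_graph T y⟩, rfl⟩
  obtain ⟨C, hC, hpre⟩ := S'.exists_preimage_norm_le hsurj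
  refine ⟨C⁻¹, by positivity, fun x hx => ?_⟩
  obtain ⟨⟨⟨a, b⟩, hp⟩, hS, hle⟩ := hpre ⟨shifted T z x, x, rfl⟩
  obtain ⟨y, rfl, rfl⟩ : ∃ y : T.domain, (y : H) = a ∧ T y = b := by
    simpa [LinearPMap.mem_graph_iff] using hp
  have hyx : shifted T z y = shifted T z x := congrArg Subtype.val hS
  have horth := hx (y - x) (by rw [map_sub, hyx, sub_self])
  -- The two preimages differ by a kernel vector, and x, being orthogonal to the kernel, is the
  -- shortest one.
  have hnorm : ‖(x : H)‖ ≤ ‖(y : H)‖ := by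
    have hpyth := norm_add_sq_eq_norm_sq_add_norm_sq_of_inner_eq_zero _ _ horth
    rw [AddSubgroupClass.coe_sub, sub_add_cancel] at hpyth
    nlinarith [norm_nonneg (y : H), norm_nonneg (x : H), norm_nonneg ((y : H) - x)]
  have hle' : ‖(y : H)‖ ≤ C * ‖shifted T z x‖ := (norm_fst_le ((y : H), T y)).trans hle
  rw [inv_mul_eq_div, div_le_iff₀ hC]
  linarith

/-- If a self-adjoint operator `T` is such that `T - t` has closed range and finite-dimensional
kernel, and `t` is in the spectrum, then `t` is an isolated point of the spectrum and an
eigenvalue of finite multiplicity. -/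
theorem isolated_of_isClosed_range {T : H →ₗ.[ℂ] H} (hT : IsSelfAdjoint T) (t : ℝ)
    (hR : IsClosed (LinearMap.range (shifted T t) : Set H))
    [FiniteDimensional ℂ (eigenspace T t)] (ht : (t : ℂ) ∈ spec T) :
    (∃ U ∈ 𝓝 (t : ℂ), spec T ∩ U = {(t : ℂ)}) ∧ eigenspace T (t : ℂ) ≠ ⊥ := by
  obtain ⟨c, hc, hbound⟩ := exists_bound_of_isClosed_range hT t hR
  refine ⟨⟨Metric.ball (t : ℂ) c, Metric.ball_mem_nhds _ hc, ?_⟩, fun hbot => ht ?_⟩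
  · ext z
    simp only [Set.mem_inter_iff, Set.mem_singleton_iff, Metric.mem_ball]
    refine ⟨fun ⟨hz, hzc⟩ => ?_, fun h => ⟨h ▸ ht, by simpa [h] using hc⟩⟩
    by_contra hne
    apply hz
    -- Split x = k + y along the kernel of T - t. On k the operator T - w is the scalar t - w; on y
    -- the gap c shrinks by at most |w - t|. The two images are orthogonal by symmetry, so
    -- Pythagoras combines the bounds.
    have hmain : ∀ w : ℂ, dist w t < c → ∀ x : T.domain,
        min (dist w t) (c - dist w t) * ‖(x : H)‖ ≤ ‖shifted T w x‖ := by
      intro w hw x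
      let K : Submodule ℂ H := (eigenspace T (t : ℂ)).map T.domain.subtype
      have : FiniteDimensional ℂ K := inferInstance
      obtain ⟨k, hk, hkx⟩ : ∃ k ∈ eigenspace T (t : ℂ), (k : H) = K.starProjection (x : H) :=
        (K.starProjection_apply_mem (x : H))
      have hk0 : shifted T t k = 0 := hk
      set y : T.domain := x - k with hy
      have horth : ∀ l : T.domain, shifted T t l = 0 → inner ℂ (l : H) (y : H) = 0 := by
        intro l hl
        have := K.sub_starProjection_mem_orthogonal (x : H)
        rw [← hkx] at this
        exact this _ ⟨l, hl, rfl⟩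
      have h1 : shifted T w x = ((t : ℂ) - w) • (k : H) + shifted T w y := by
        have : shifted T w x = shifted T w k + shifted T w y := by rw [← map_add, hy]; congr 1; abel
        rw [this]
        congr 1
        rw [shifted_apply] at hk0 ⊢
        rw [sub_eq_zero.mp hk0, sub_smul]
      have h2 : inner ℂ (k : H) (shifted T w y) = 0 := by
        rw [shifted_apply, inner_sub_right, inner_smul_right, ← hT.inner_linearPMap]
        rw [shifted_apply] at hk0
        rw [sub_eq_zero.mp hk0, inner_smul_left, horth k hk0]
        simp
      have h3 : ‖shifted T w x‖ ^ 2 = (dist w t * ‖(k : H)‖) ^ 2 + ‖shifted T w y‖ ^ 2 := by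
        have hp := norm_add_sq_eq_norm_sq_add_norm_sq_of_inner_eq_zero
          (((t : ℂ) - w) • (k : H)) (shifted T w y) (by rw [inner_smul_left, h2, mul_zero])
        rw [← h1, norm_smul, ← dist_eq_norm, dist_comm] at hp
        linarith
      have h4 : ‖(x : H)‖ ^ 2 = ‖(k : H)‖ ^ 2 + ‖(y : H)‖ ^ 2 := by
        have hp := norm_add_sq_eq_norm_sq_add_norm_sq_of_inner_eq_zero (k : H) (y : H)
          (horth k hk0)
        have : (k : H) + (y : H) = x := by rw [hy]; simp
        rw [this] at hp
        linarith
      have h5 : (c - dist w t) * ‖(y : H)‖ ≤ ‖shifted T w y‖ := by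
        have : shifted T t y = shifted T w y + (w - t) • (y : H) := by
          simp only [shifted_apply, sub_smul]; abel
        have h6 := hbound y horth
        have h7 := norm_add_le (shifted T w y) ((w - t) • (y : H))
        rw [← this, norm_smul, ← dist_eq_norm] at h7
        linarith
      set m := min (dist w t) (c - dist w t) with hm
      have hm0 : 0 ≤ m := le_min dist_nonneg (by linarith)
      have h8 : (m * ‖(k : H)‖) ^ 2 ≤ (dist w t * ‖(k : H)‖) ^ 2 := by
        gcongr; exact min_le_left _ _
      have h9 : (m * ‖(y : H)‖) ^ 2 ≤ ‖shifted T w y‖ ^ 2 := by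
        refine pow_le_pow_left₀ (by positivity) (le_trans ?_ h5) 2
        gcongr; exact min_le_right _ _
      refine le_of_sq_le_sq ?_ (norm_nonneg _)
      rw [h3, mul_pow, h4]
      nlinarith
    have hconj : dist (starRingEnd ℂ z) (t : ℂ) = dist z t := by
      rw [← Complex.conj_ofReal t, Complex.dist_conj_conj, Complex.conj_ofReal]
    refine isResolventPoint_of_bound hT z (lt_min (dist_pos.mpr hne) (sub_pos.mpr hzc))
      (hmain z hzc) ?_
    have := hmain (starRingEnd ℂ z) (hconj ▸ hzc)
    rwa [hconj] at this
  · have hb : ∀ x : T.domain, c * ‖(x : H)‖ ≤ ‖shifted T t x‖ := fun x =>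
      hbound x fun y hy => by
        have : y ∈ eigenspace T (t : ℂ) := hy
        rw [hbot, Submodule.mem_bot] at this
        simp [this]
    exact isResolventPoint_of_bound hT t hc hb (by rwa [Complex.conj_ofReal])

/-- A self-adjoint operator `T` with `T - z` bounded below on a subspace of its domain, whose image
under `T - z` has finite-dimensional orthogonal complement, is such that `T - z` has closed
range. -/
theorem isClosed_range_shifted {T : H →ₗ.[ℂ] H} (hT : IsSelfAdjoint T) (z : ℂ) {c : ℝ}
    (hc : 0 < c) (V : Submodule ℂ T.domain) (hV : ∀ x ∈ V, c * ‖(x : H)‖ ≤ ‖shifted T z x‖)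
    [FiniteDimensional ℂ (V.map (shifted T z))ᗮ] :
    IsClosed (LinearMap.range (shifted T z) : Set H) := by
  have hle := topologicalClosure_map_shifted_le hT z hc V hV
  set W := (V.map (shifted T z)).topologicalClosure with hW
  have hWc : IsClosed (W : Set H) := Submodule.isClosed_topologicalClosure _
  have : CompleteSpace W := hWc.completeSpace_coe
  have : FiniteDimensional ℂ Wᗮ := by
    rw [hW, Submodule.orthogonal_closure]; infer_instance
  have hsup : LinearMap.range (shifted T z) = W ⊔ (Wᗮ ⊓ LinearMap.range (shifted T z)) :=
    (Submodule.sup_orthogonal_inf_of_hasOrthogonalProjection hle).symm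
  rw [hsup]
  have : FiniteDimensional ℂ (Wᗮ ⊓ LinearMap.range (shifted T z) : Submodule ℂ H) :=
    Submodule.finiteDimensional_of_le inf_le_left
  exact Submodule.isClosed_sup_finiteDimensional _ _ hWc

end BlockJacobi

end SelfAdjoint

/-! ### The block Jacobi operator and its eigenvalue recursion. -/

namespace BlockJacobi

variable {d : ℕ}

theorem op_conjTranspose (M : Mat d) : op Mᴴ = ContinuousLinearMap.adjoint (op M) :=
  map_star (Matrix.toEuclideanCLM (n := Fin d) (𝕜 := ℂ)) M

theorem norm_op_conjTranspose (M : Mat d) : ‖op Mᴴ‖ = ‖op M‖ := by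
  rw [op_conjTranspose]
  exact LinearIsometryEquiv.norm_map ContinuousLinearMap.adjoint (op M)

theorem inner_op (M : Mat d) (x y : EuclideanSpace ℂ (Fin d)) :
    inner ℂ (op M x) y = inner ℂ x (op Mᴴ y) := by
  rw [op_conjTranspose, ContinuousLinearMap.adjoint_inner_right]

theorem op_mul_apply (M N : Mat d) (x : EuclideanSpace ℂ (Fin d)) :
    op (M * N) x = op M (op N x) := by
  rw [op, map_mul]; rfl

theorem op_one_apply (x : EuclideanSpace ℂ (Fin d)) : op (1 : Mat d) x = x := by
  rw [op, map_one]; rfl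

theorem op_sub_apply (M N : Mat d) (x : EuclideanSpace ℂ (Fin d)) :
    op (M - N) x = op M x - op N x := by
  rw [op, map_sub]; rfl

theorem op_add_apply (M N : Mat d) (x : EuclideanSpace ℂ (Fin d)) :
    op (M + N) x = op M x + op N x := by
  rw [op, map_add]; rfl

theorem op_injective_of_isUnit {M : Mat d} (hM : IsUnit M) {x : EuclideanSpace ℂ (Fin d)}
    (hx : op M x = 0) : x = 0 := by
  obtain ⟨N, hN⟩ := hM.exists_left_inv
  rw [← op_one_apply x, ← hN, op_mul_apply, hx, map_zero]

theorem single_mem_finSupp (j : ℕ) (ξ : EuclideanSpace ℂ (Fin d)) :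
    (lp.single 2 j ξ : L2 d) ∈ finSupp d :=
  ⟨j + 1, fun i hi =>
    lp.single_apply_ne (E := fun _ : ℕ => EuclideanSpace ℂ (Fin d)) 2 j ξ
      (show i ≠ j by omega)⟩

/-- The formal action of the Jacobi matrix at a site is obtained by pairing with a sequence
supported at this site. -/
theorem inner_minimal_single (A B : ℕ → Mat d) (hB : ∀ n, (B n).IsHermitian) (j : ℕ)
    (ξ : EuclideanSpace ℂ (Fin d)) (v : L2 d) :
    inner ℂ (minimal A B ⟨lp.single 2 j ξ, single_mem_finSupp j ξ⟩) v =
      inner ℂ ξ (formal A B v j) := by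
  have hval : ∀ i, (minimal A B ⟨lp.single 2 j ξ, single_mem_finSupp j ξ⟩ : L2 d) i =
      formal A B (Pi.single j ξ) i := fun _ => rfl
  cases j with
  | zero =>
    have : (minimal A B ⟨lp.single 2 0 ξ, single_mem_finSupp 0 ξ⟩ : L2 d) =
        lp.single 2 0 (op (B 0) ξ) + lp.single 2 1 (op (A 0)ᴴ ξ) := by
      ext1
      funext i
      rw [hval]
      rcases i with _ | _ | i <;> simp [formal]
    rw [this, inner_add_left, lp.inner_single_left, lp.inner_single_left, inner_op, inner_op,
      (hB 0).eq, Matrix.conjTranspose_conjTranspose, ← inner_add_right]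
    rfl
  | succ j =>
    have : (minimal A B ⟨lp.single 2 (j + 1) ξ, single_mem_finSupp (j + 1) ξ⟩ : L2 d) =
        lp.single 2 j (op (A j) ξ) + lp.single 2 (j + 1) (op (B (j + 1)) ξ) +
          lp.single 2 (j + 2) (op (A (j + 1))ᴴ ξ) := by
      ext1
      funext i
      rw [hval]
      simp only [lp.coeFn_add, lp.coeFn_single, Pi.add_apply]
      rcases lt_trichotomy i j with h | rfl | h
      · rcases i with _ | i <;> simp [formal, Pi.single_apply] <;> split_ifs <;> first | omega | simp
      · rcases i with _ | i
        · simp [formal]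
        · simp [formal, show i ≠ i + 1 + 1 by omega]
      · obtain ⟨i, rfl⟩ : ∃ k, i = j + 1 + k := ⟨i - (j + 1), by omega⟩
        rcases i with _ | _ | i
        · simp [formal]
        · simp [formal, show j + 1 + 1 ≠ j by omega]
        · have : j + 1 + (i + 1 + 1) = (j + 1 + (i + 1)) + 1 := by omega
          rw [this]
          simp [formal, Pi.single_apply]
          split_ifs <;> first | omega | simp
    rw [this, inner_add_left, inner_add_left, lp.inner_single_left, lp.inner_single_left,
      lp.inner_single_left, inner_op, inner_op, inner_op, (hB _).eq,
      Matrix.conjTranspose_conjTranspose, ← inner_add_right, ← inner_add_right]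
    rfl

/-- The square-summable sequences that solve the eigenvalue equation at all sites from `m` on. -/
def solutions (A B : ℕ → Mat d) (z : ℂ) (m : ℕ) : Submodule ℂ (L2 d) where
  carrier := {v | ∀ j ≥ m, formal A B v j = z • v j}
  zero_mem' j _ := by cases j <;> simp [formal]
  add_mem' {u v} hu hv j hj := by
    rw [lp.coeFn_add, formal_add, Pi.add_apply, Pi.add_apply, hu j hj, hv j hj, smul_add]
  smul_mem' c u hu j hj := by
    rw [lp.coeFn_smul, formal_smul, Pi.smul_apply, Pi.smul_apply, hu j hj, smul_comm]

/-- Invertibility of `A j` determines entry j + 1 from the earlier ones for j ≥ m, so the entries 0,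
…, m determine a solution. -/
theorem finiteDimensional_solutions (A B : ℕ → Mat d) (hA : ∀ n, IsUnit (A n)) (z : ℂ) (m : ℕ) :
    FiniteDimensional ℂ (solutions A B z m) := by
  let f : solutions A B z m →ₗ[ℂ] (Fin (m + 1) → EuclideanSpace ℂ (Fin d)) :=
    { toFun := fun v i => (v : L2 d) i
      map_add' := fun _ _ => rfl
      map_smul' := fun _ _ => rfl }
  refine FiniteDimensional.of_injective f ((injective_iff_map_eq_zero f).mpr fun v hv => ?_)
  have hle : ∀ j ≤ m, (v : L2 d) j = 0 := fun j hj => congrFun hv ⟨j, by omega⟩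
  have hall : ∀ j, ∀ i ≤ j, (v : L2 d) i = 0 := by
    intro j
    induction j with
    | zero => intro i hi; exact hle i (by omega)
    | succ j ih =>
      intro i hi
      rcases Nat.lt_or_ge j i with h | h
      · obtain rfl : i = j + 1 := by omega
        rcases Nat.lt_or_ge j m with hjm | hjm
        · exact hle _ (by omega)
        · have heq := v.2 j hjm
          refine op_injective_of_isUnit (hA j) ?_
          rcases j with _ | j
          · simpa [formal, ih 0 (by omega)] using heq
          · simpa [formal, ih j (by omega), ih (j + 1) (by omega)] using heq
      · exact ih i h
  ext1
  ext1
  funext j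
  exact hall j j le_rfl

/-- The finitely supported sequences that vanish at the sites before `m`, as a subspace of the
domain of an operator. -/
def finSuppFrom (J : L2 d →ₗ.[ℂ] L2 d) (m : ℕ) : Submodule ℂ J.domain where
  carrier := {x | (x : L2 d) ∈ finSupp d ∧ ∀ j < m, (x : L2 d) j = 0}
  zero_mem' := ⟨(finSupp d).zero_mem, fun _ _ => rfl⟩
  add_mem' {x y} hx hy := by
    refine ⟨(finSupp d).add_mem hx.1 hy.1, fun j hj => ?_⟩
    simp [hx.2 j hj, hy.2 j hj]
  smul_mem' c x hx := by
    refine ⟨(finSupp d).smul_mem c hx.1, fun j hj => ?_⟩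
    simp [hx.2 j hj]

/-- Testing against sequences supported at a single site j ≥ m gives the recursion at j; no domain
condition on the orthogonal vector is needed. -/
theorem orthogonal_map_shifted_le (A B : ℕ → Mat d) (hB : ∀ n, (B n).IsHermitian)
    {J : L2 d →ₗ.[ℂ] L2 d} (hext : minimal A B ≤ J) (t : ℝ) (m : ℕ) :
    ((finSuppFrom J m).map (shifted J t))ᗮ ≤ solutions A B t m := by
  intro v hv j hj
  refine ext_inner_left ℂ fun ξ => ?_
  let x : (minimal A B).domain := ⟨lp.single 2 j ξ, single_mem_finSupp j ξ⟩
  let y : J.domain := ⟨lp.single 2 j ξ, hext.1 x.2⟩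
  have hxy : minimal A B x = J y := hext.2 (x := x) (y := y) rfl
  have hy : y ∈ finSuppFrom J m := ⟨x.2, fun i hi =>
    lp.single_apply_ne (E := fun _ : ℕ => EuclideanSpace ℂ (Fin d)) 2 j ξ
      (show i ≠ j by omega)⟩
  have h := hv _ ⟨y, hy, rfl⟩
  have hx : inner ℂ (minimal A B x) v = inner ℂ ξ (formal A B v j) :=
    inner_minimal_single A B hB j ξ v
  rw [shifted_apply, ← hxy, inner_sub_left, hx, inner_smul_left, Complex.conj_ofReal,
    lp.inner_single_left, sub_eq_zero] at h
  rw [h, inner_smul_right]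

/-- By symmetry an eigenvector is orthogonal to the range of J - t, hence solves the recursion from
site 0. -/
theorem finiteDimensional_eigenspace (A B : ℕ → Mat d) (hA : ∀ n, IsUnit (A n))
    (hB : ∀ n, (B n).IsHermitian) {J : L2 d →ₗ.[ℂ] L2 d} (hJ : IsSelfAdjoint J)
    (hext : minimal A B ≤ J) (t : ℝ) : FiniteDimensional ℂ (eigenspace J (t : ℂ)) := by
  have hfin := finiteDimensional_solutions A B hA t 0
  let f : eigenspace J (t : ℂ) →ₗ[ℂ] L2 d := J.domain.subtype ∘ₗ (eigenspace J (t : ℂ)).subtype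
  have hmem : ∀ v, f v ∈ solutions A B t 0 := by
    intro v
    refine orthogonal_map_shifted_le A B hB hext t 0 ?_
    rintro _ ⟨y, -, rfl⟩
    have hv : shifted J t v = 0 := v.2
    rw [shifted_apply, sub_eq_zero] at hv
    change inner ℂ (shifted J t y) ((v : J.domain) : L2 d) = 0
    rw [shifted_apply, inner_sub_left, hJ.inner_linearPMap, hv, inner_smul_left, inner_smul_right,
      Complex.conj_ofReal, sub_self]
  refine FiniteDimensional.of_injective (f.codRestrict _ hmem) fun v w h => ?_
  have hfv : f v = f w :=
    congrArg (fun s : solutions A B (t : ℂ) 0 => (s : L2 d)) h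
  exact Subtype.ext (Subtype.ext hfv)

end BlockJacobi

/-! ### Functional calculus of the diagonal blocks and the estimate on one link. -/

noncomputable section

namespace BlockJacobi

variable {d : ℕ}

/-- The square root of the positive part of a Hermitian matrix. -/
def posSqrt (B : Mat d) : Mat d := cfc Real.sqrt B

/-- The square root of the negative part of a Hermitian matrix. -/
def negSqrt (B : Mat d) : Mat d := cfc (fun x : ℝ => √(-x)) B

/-- The orthogonal projection onto the range of the positive part of a Hermitian matrix. -/
def posProj (B : Mat d) : Mat d := cfc (fun x : ℝ => if 0 < x then 1 else 0) B

/-- The reflection that is `1` on the range of the positive part of a Hermitian matrix and `-1` on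
its orthogonal complement. -/
def sgn (B : Mat d) : Mat d := 2 * posProj B - 1

theorem conjTranspose_cfc (f : ℝ → ℝ) (B : Mat d) : (cfc f B)ᴴ = cfc f B :=
  (cfc_predicate f B : IsSelfAdjoint (cfc f B))

theorem continuousOn_spectrum (f : ℝ → ℝ) (B : Mat d) : ContinuousOn f (spectrum ℝ B) :=
  B.finite_real_spectrum.continuousOn f

theorem cfc_mul_matrix (f g : ℝ → ℝ) (B : Mat d) :
    cfc f B * cfc g B = cfc (fun x => f x * g x) B :=
  (cfc_mul f g B (continuousOn_spectrum f B) (continuousOn_spectrum g B)).symm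

theorem cfc_add_matrix (f g : ℝ → ℝ) (B : Mat d) :
    cfc f B + cfc g B = cfc (fun x => f x + g x) B :=
  (cfc_add B f g (continuousOn_spectrum f B) (continuousOn_spectrum g B)).symm

theorem posInvSqrt_eq {B : Mat d} (hB : B.IsHermitian) :
    posInvSqrt B = cfc (fun x : ℝ => √(if 0 < x then x⁻¹ else 0)) B :=
  (cfc_comp Real.sqrt (fun x : ℝ => if 0 < x then x⁻¹ else 0) B hB.isSelfAdjoint
    ((B.finite_real_spectrum.image _).continuousOn _) (continuousOn_spectrum _ B)).symm

theorem posInvSqrt_mul_self {B : Mat d} (hB : B.IsHermitian) :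
    posInvSqrt B * posInvSqrt B = posInv B := by
  rw [posInvSqrt_eq hB, cfc_mul_matrix, posInv]
  congr 1
  funext x
  refine Real.mul_self_sqrt ?_
  split_ifs with h
  · positivity
  · rfl

theorem conjTranspose_posInvSqrt (B : Mat d) : (posInvSqrt B)ᴴ = posInvSqrt B :=
  conjTranspose_cfc _ _

theorem conjTranspose_posSqrt (B : Mat d) : (posSqrt B)ᴴ = posSqrt B := conjTranspose_cfc _ _

theorem conjTranspose_negSqrt (B : Mat d) : (negSqrt B)ᴴ = negSqrt B := conjTranspose_cfc _ _

theorem conjTranspose_posProj (B : Mat d) : (posProj B)ᴴ = posProj B := conjTranspose_cfc _ _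

theorem posProj_mul_self (B : Mat d) : posProj B * posProj B = posProj B := by
  rw [posProj, cfc_mul_matrix]
  congr 1
  funext x
  split_ifs <;> simp

/-- This factorization brings the normalized off-diagonal blocks of the limsup condition into the
link terms. -/
theorem posInvSqrt_mul_posSqrt {B : Mat d} (hB : B.IsHermitian) :
    posInvSqrt B * posSqrt B = posProj B := by
  rw [posInvSqrt_eq hB, posSqrt, cfc_mul_matrix, posProj]
  congr 1
  funext x
  split_ifs with h
  · rw [Real.sqrt_inv, inv_mul_cancel₀ (Real.sqrt_pos.mpr h).ne']
  · simp

/-- Both sides are |B| = B₊ + B₋. -/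
theorem mul_sgn {B : Mat d} (hB : B.IsHermitian) :
    B * sgn B = posSqrt B * posSqrt B + negSqrt B * negSqrt B := by
  have hid : cfc (fun x : ℝ => x) B = B := cfc_id' ℝ B hB.isSelfAdjoint
  have hE : B * posProj B = cfc (fun x : ℝ => x * if 0 < x then 1 else 0) B := by
    rw [← cfc_mul_matrix (fun x => x), hid, posProj]
  have hsum : posSqrt B * posSqrt B + negSqrt B * negSqrt B + B =
      cfc (fun x : ℝ => √x * √x + √(-x) * √(-x) + x) B := by
    rw [← cfc_add_matrix _ (fun x => x), hid, ← cfc_add_matrix, ← cfc_mul_matrix, ← cfc_mul_matrix,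
      posSqrt, negSqrt]
  rw [sgn, mul_sub, mul_one, two_mul, mul_add, hE, cfc_add_matrix, sub_eq_iff_eq_add, hsum]
  congr 1
  funext x
  split_ifs with h
  · rw [Real.mul_self_sqrt h.le, Real.sqrt_eq_zero_of_nonpos (by linarith : -x ≤ 0)]
    ring
  · rw [Real.mul_self_sqrt (by linarith : 0 ≤ -x), Real.sqrt_eq_zero_of_nonpos (not_lt.mp h)]
    ring

theorem conjTranspose_sgn (B : Mat d) : (sgn B)ᴴ = sgn B := by
  rw [sgn, two_mul, Matrix.conjTranspose_sub, Matrix.conjTranspose_add, conjTranspose_posProj,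
    Matrix.conjTranspose_one]

theorem sgn_mul_self (B : Mat d) : sgn B * sgn B = 1 := by
  have : sgn B * sgn B = 4 * (posProj B * posProj B) - 4 * posProj B + 1 := by
    rw [sgn]; noncomm_ring
  rw [this, posProj_mul_self, sub_self, zero_add]

theorem norm_op_sgn (B : Mat d) (x : EuclideanSpace ℂ (Fin d)) : ‖op (sgn B) x‖ = ‖x‖ := by
  have h : inner ℂ (op (sgn B) x) (op (sgn B) x) = inner ℂ x x := by
    rw [inner_op, conjTranspose_sgn, ← op_mul_apply, sgn_mul_self, op_one_apply]
  rw [@norm_eq_sqrt_re_inner ℂ, h, ← @norm_eq_sqrt_re_inner ℂ]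

theorem inner_op_self_of_conjTranspose {M : Mat d} (hM : Mᴴ = M)
    (x : EuclideanSpace ℂ (Fin d)) : (inner ℂ (op (M * M) x) x).re = ‖op M x‖ ^ 2 := by
  rw [op_mul_apply, inner_op, hM, inner_self_eq_norm_sq_to_K]
  norm_cast

theorem norm_sq_posSqrt_le {B : Mat d} (hB : B.IsHermitian) (x : EuclideanSpace ℂ (Fin d)) :
    ‖op (posSqrt B) x‖ ^ 2 ≤ (inner ℂ (op B x) (op (sgn B) x)).re := by
  have h : inner ℂ (op B x) (op (sgn B) x) = inner ℂ x (op (B * sgn B) x) := by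
    rw [inner_op, hB.eq, op_mul_apply]
  rw [h, ← inner_conj_symm, Complex.conj_re, mul_sgn hB, op_add_apply, inner_add_left,
    Complex.add_re, inner_op_self_of_conjTranspose (conjTranspose_posSqrt B),
    inner_op_self_of_conjTranspose (conjTranspose_negSqrt B)]
  linarith [sq_nonneg ‖op (negSqrt B) x‖]

theorem op_sgn_apply (B : Mat d) (x : EuclideanSpace ℂ (Fin d)) :
    op (sgn B) x = op (posProj B) x + op (posProj B) x - x := by
  rw [sgn, two_mul, op_sub_apply, op_add_apply, op_one_apply]

/-- Multiplied by -t, this is the source of the gain t‖x‖²; the loss is confined to the positive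
subspace. -/
theorem inner_sgn (B : Mat d) (x : EuclideanSpace ℂ (Fin d)) :
    (inner ℂ x (op (sgn B) x)).re = 2 * ‖op (posProj B) x‖ ^ 2 - ‖x‖ ^ 2 := by
  have hx : (inner ℂ x x).re = ‖x‖ ^ 2 := inner_self_eq_norm_sq (𝕜 := ℂ) x
  rw [← inner_op_self_of_conjTranspose (conjTranspose_posProj B), posProj_mul_self, op_sgn_apply,
    inner_sub_right, inner_add_right, Complex.sub_re, Complex.add_re, hx, ← inner_conj_symm x,
    Complex.conj_re]
  ring

theorem norm_op_posInvSqrt_sq {B : Mat d} (hB : B.IsHermitian) :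
    ‖op (posInvSqrt B)‖ ^ 2 = ‖op (posInv B)‖ := by
  have h : op (posInv B) =
      ContinuousLinearMap.adjoint (op (posInvSqrt B)) ∘L op (posInvSqrt B) := by
    rw [← op_conjTranspose, conjTranspose_posInvSqrt, ← posInvSqrt_mul_self hB]
    exact map_mul (Matrix.toEuclideanCLM (n := Fin d) (𝕜 := ℂ)) _ _
  rw [h, ContinuousLinearMap.norm_adjoint_comp_self, sq]

/-- Controls that loss at odd sites, where only the positive part of the block is known to be large.
-/
theorem norm_sq_posProj_le {B : Mat d} (hB : B.IsHermitian) (x : EuclideanSpace ℂ (Fin d)) :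
    ‖op (posProj B) x‖ ^ 2 ≤ ‖op (posInv B)‖ * ‖op (posSqrt B) x‖ ^ 2 := by
  rw [← posInvSqrt_mul_posSqrt hB, op_mul_apply, ← norm_op_posInvSqrt_sq hB, ← mul_pow]
  gcongr
  exact ContinuousLinearMap.le_opNorm _ _

theorem le_of_mem_spectrum {B : Mat d} {M : ℝ}
    (hM : (B - (M : ℂ) • (1 : Mat d)).PosSemidef) {x : ℝ} (hx : x ∈ spectrum ℝ B) : M ≤ x := by
  have hmem : x - M ∈ spectrum ℝ (B - (M : ℂ) • (1 : Mat d)) := by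
    have halg : (M : ℂ) • (1 : Mat d) = algebraMap ℝ (Mat d) M := by
      rw [Algebra.algebraMap_eq_smul_one, Complex.coe_smul]
    rw [spectrum.mem_iff] at hx ⊢
    rwa [halg, map_sub, sub_sub_sub_cancel_right]
  obtain ⟨i, hi⟩ := hM.1.spectrum_real_eq_range_eigenvalues ▸ hmem
  linarith [hM.eigenvalues_nonneg i]

theorem posProj_eq_one {B : Mat d} (hB : B.IsHermitian) (hpos : ∀ x ∈ spectrum ℝ B, 0 < x) :
    posProj B = 1 := by
  rw [posProj, cfc_congr (g := fun _ => 1) fun x hx => by simp [hpos x hx],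
    cfc_const_one ℝ B hB.isSelfAdjoint]

theorem invSqrt_eq_posInvSqrt {B : Mat d} (hB : B.IsHermitian)
    (hpos : ∀ x ∈ spectrum ℝ B, 0 < x) : invSqrt B = posInvSqrt B := by
  rw [posInvSqrt_eq hB, invSqrt]
  refine cfc_congr fun x hx => ?_
  have h := hpos x hx
  simp only [h, if_true]
  rw [Real.rpow_neg h.le, ← Real.sqrt_eq_rpow, Real.sqrt_inv]

/-- The counterpart for even sites, where the whole spectrum is bounded below. -/
theorem mul_norm_sq_posProj_le {B : Mat d} {M : ℝ} (hM : ∀ x ∈ spectrum ℝ B, M ≤ x)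
    (x : EuclideanSpace ℂ (Fin d)) :
    M * ‖op (posProj B) x‖ ^ 2 ≤ ‖op (posSqrt B) x‖ ^ 2 := by
  -- A square root of B₊ - M E, which is nonnegative because the spectrum lies above M.
  set G : Mat d := cfc (fun y : ℝ => √(√y * √y - M * if 0 < y then 1 else 0)) B with hG
  have hadd : posSqrt B * posSqrt B = (M : ℂ) • (posProj B * posProj B) + G * G := by
    have hsmul : (M : ℂ) • posProj B = cfc (fun y : ℝ => M * if 0 < y then 1 else 0) B := by
      rw [Complex.coe_smul, posProj, ← cfc_const_mul M _ B (continuousOn_spectrum _ B)]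
    rw [posProj_mul_self, hsmul, hG, posSqrt, cfc_mul_matrix, cfc_mul_matrix, cfc_add_matrix]
    refine cfc_congr fun y hy => ?_
    have hMy := hM y hy
    have hnonneg : 0 ≤ √y * √y - M * if 0 < y then 1 else 0 := by
      split_ifs with h
      · rw [Real.mul_self_sqrt h.le]; linarith
      · simp only [mul_zero, sub_zero]; positivity
    rw [Real.mul_self_sqrt hnonneg, add_sub_cancel]
  rw [← inner_op_self_of_conjTranspose (conjTranspose_posSqrt B),
    ← inner_op_self_of_conjTranspose (conjTranspose_posProj B), hadd, op_add_apply, inner_add_left,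
    Complex.add_re, inner_op_self_of_conjTranspose (conjTranspose_cfc _ _)]
  have : op ((M : ℂ) • (posProj B * posProj B)) x = (M : ℂ) • op (posProj B * posProj B) x := by
    rw [op, map_smul]; rfl
  rw [this, inner_smul_left, Complex.conj_ofReal, Complex.re_ofReal_mul]
  linarith [sq_nonneg ‖op G x‖]

/-- If one of the two reflections is the identity, the contributions of the -1 eigenspace of the
other cancel between the two adjoint terms, leaving only the positive parts. No bound on A over the
negative subspace is required. -/
theorem re_inner_link_le {B C : Mat d} (hB : B.IsHermitian) (hC : C.IsHermitian) (A : Mat d)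
    (h : posProj B = 1 ∨ posProj C = 1) (u v : EuclideanSpace ℂ (Fin d)) :
    |(inner ℂ (op A v) (op (sgn B) u)).re + (inner ℂ (op Aᴴ u) (op (sgn C) v)).re| ≤
      2 * (‖op (posInvSqrt B * A * posInvSqrt C)‖ * ‖op (posSqrt B) u‖ * ‖op (posSqrt C) v‖) := by
  have hsum : (inner ℂ (op A v) (op (sgn B) u)).re + (inner ℂ (op Aᴴ u) (op (sgn C) v)).re =
      2 * (inner ℂ (op A (op (posProj C) v)) (op (posProj B) u)).re := by
    have hadj : (inner ℂ (op Aᴴ u) (op (sgn C) v)).re = (inner ℂ (op A (op (sgn C) v)) u).re := by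
      rw [inner_op, Matrix.conjTranspose_conjTranspose, ← inner_conj_symm, Complex.conj_re]
    rw [hadj, op_sgn_apply, op_sgn_apply]
    rcases h with h | h <;> rw [h, op_one_apply, add_sub_cancel_right] <;>
      simp only [map_sub, map_add, inner_sub_left, inner_sub_right, inner_add_left,
        inner_add_right, Complex.sub_re, Complex.add_re] <;> ring
  have hform : inner ℂ (op A (op (posProj C) v)) (op (posProj B) u) =
      inner ℂ (op (posInvSqrt B * A * posInvSqrt C) (op (posSqrt C) v)) (op (posSqrt B) u) := by
    rw [← posInvSqrt_mul_posSqrt hB, ← posInvSqrt_mul_posSqrt hC, op_mul_apply, op_mul_apply,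
      op_mul_apply, op_mul_apply, inner_op (posInvSqrt B), conjTranspose_posInvSqrt]
  rw [hsum, hform, abs_mul, abs_two]
  gcongr
  refine (Complex.abs_re_le_norm _).trans ((norm_inner_le_norm _ _).trans ?_)
  rw [mul_right_comm]
  gcongr
  exact ContinuousLinearMap.le_opNorm _ _

theorem tendsto_norm_op {ι : Type*} {l : Filter ι} {M : ι → Mat d} (hM : Tendsto M l (𝓝 0)) :
    Tendsto (fun i => ‖op (M i)‖) l (𝓝 0) := by
  have hc : Continuous fun M : Mat d => op M :=
    (Matrix.toEuclideanCLM (n := Fin d) (𝕜 := ℂ)).toAlgEquiv.toLinearMap.continuous_of_finiteDimensional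
  have := (hc.norm.tendsto 0).comp hM
  simpa [Function.comp_def] using this

end BlockJacobi
end

/-! ### The lower bound far from the origin. -/

namespace BlockJacobi

variable {d : ℕ}

/-- Summation of the contributions of the sites and links of a chain: `D j` is the contribution of
the site `j`, and `X j`, `Y j` are the two contributions of the link between `j` and `j + 1`. -/
theorem chain_lower_bound {T D X Y W N γ : ℕ → ℝ} {t ρ : ℝ} (hT0 : T 0 = D 0 + X 0)
    (hT : ∀ j, T (j + 1) = Y j + D (j + 1) + X (j + 1)) (hW : ∀ j, 0 ≤ W j) (hγ : ∀ j, 0 ≤ γ j)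
    (hρ : ∀ j, γ j + γ (j + 1) = ρ) (hD : ∀ j, t * N j + ρ * W j ≤ D j)
    (hXY : ∀ j, -(γ j * (W j + W (j + 1))) ≤ X j + Y j) (n : ℕ) :
    t * ∑ j ∈ Finset.range (n + 1), N j + γ n * W n + X n ≤ ∑ j ∈ Finset.range (n + 1), T j := by
  -- The term `γ n * W n` is the share of site n reserved for the link to n + 1, whose half `X n` is
  -- not yet paired with `Y n`.
  induction n with
  | zero =>
    have h1 := mul_nonneg (hγ 1) (hW 0)
    have h2 := hD 0
    rw [← hρ 0, zero_add] at h2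
    simp only [zero_add, Finset.range_one, Finset.sum_singleton, hT0]
    nlinarith
  | succ n ih =>
    rw [Finset.sum_range_succ _ (n + 1), Finset.sum_range_succ _ (n + 1), hT]
    have h1 := hD (n + 1)
    rw [← hρ n] at h1
    nlinarith [hXY n]

theorem sum_norm_sq_le (f : L2 d) (s : Finset ℕ) : ∑ j ∈ s, ‖f j‖ ^ 2 ≤ ‖f‖ ^ 2 := by
  have h := lp.sum_rpow_le_norm_rpow (p := 2) (by norm_num) f s
  simpa using h

theorem norm_sq_eq_sum (f : L2 d) {n : ℕ} (hf : ∀ j ≥ n, f j = 0) :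
    ‖f‖ ^ 2 = ∑ j ∈ Finset.range n, ‖f j‖ ^ 2 := by
  have h := lp.norm_rpow_eq_tsum (p := 2) (by norm_num) f
  rw [tsum_eq_sum (s := Finset.range n) fun j hj => by
    rw [hf j (by simpa using hj)]; simp] at h
  simpa using h

/-- If the diagonal blocks with even index are positive definite, the positive parts of all diagonal
blocks are large, and the off-diagonal blocks are small relative to them, then `J - t` is bounded
below on finitely supported sequences. -/
theorem mul_norm_le_norm_shifted (A B : ℕ → Mat d) (hB : ∀ n, (B n).IsHermitian)
    {J : L2 d →ₗ.[ℂ] L2 d} (hext : minimal A B ≤ J) {t ρ : ℝ} (ht : 0 < t) (γ : ℕ → ℝ)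
    (hγ : ∀ j, 0 ≤ γ j) (hρ : ∀ j, γ j + γ (j + 1) = ρ) (m : ℕ)
    (hpos : ∀ j ≥ m, Even j → posProj (B j) = 1)
    (hlarge : ∀ j ≥ m, ∀ x : EuclideanSpace ℂ (Fin d),
      2 * t * ‖op (posProj (B j)) x‖ ^ 2 ≤ (1 - ρ) * ‖op (posSqrt (B j)) x‖ ^ 2)
    (hlink : ∀ j ≥ m, ‖op (posInvSqrt (B j) * A j * posInvSqrt (B (j + 1)))‖ ≤ γ j)
    (x : J.domain) (hx : x ∈ finSuppFrom J m) : t * ‖(x : L2 d)‖ ≤ ‖shifted J t x‖ := by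
  obtain ⟨hfin, hlow⟩ := hx
  set u : L2 d := (x : L2 d) with hu
  obtain ⟨n, hn⟩ := id hfin
  have hJx : ∀ j, (shifted J t x) j = formal A B u j - (t : ℂ) • u j := by
    intro j
    have : minimal A B ⟨u, hfin⟩ = J x := hext.2 rfl
    rw [shifted_apply, ← this]
    rfl
  have hlow' : ∀ j, m ≤ j ∨ u j = 0 := fun j => (le_or_gt m j).imp_right (hlow j)
  have hchain := chain_lower_bound (t := t) (ρ := ρ) (γ := γ)
    (T := fun j => (inner ℂ (shifted J t x j) (op (sgn (B j)) (u j))).re)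
    (D := fun j => (inner ℂ (op (B j) (u j)) (op (sgn (B j)) (u j))).re -
      t * (inner ℂ (u j) (op (sgn (B j)) (u j))).re)
    (X := fun j => (inner ℂ (op (A j) (u (j + 1))) (op (sgn (B j)) (u j))).re)
    (Y := fun j => (inner ℂ (op (A j)ᴴ (u j)) (op (sgn (B (j + 1))) (u (j + 1)))).re)
    (W := fun j => ‖op (posSqrt (B j)) (u j)‖ ^ 2) (N := fun j => ‖u j‖ ^ 2)
    (by
      simp only [hJx, formal, inner_sub_left, inner_add_left, inner_smul_left, Complex.conj_ofReal,
        Complex.sub_re, Complex.add_re, Complex.re_ofReal_mul]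
      ring)
    (fun j => by
      simp only [hJx, formal, inner_sub_left, inner_add_left, inner_smul_left, Complex.conj_ofReal,
        Complex.sub_re, Complex.add_re, Complex.re_ofReal_mul]
      ring)
    (fun j => sq_nonneg _) hγ hρ
    (fun j => by
      rcases hlow' j with hj | hj
      · have h1 := norm_sq_posSqrt_le (hB j) (u j)
        have h2 := hlarge j hj (u j)
        simp only [inner_sgn]
        nlinarith
      · simp [hj])
    (fun j => by
      rcases hlow' j with hj | hj
      · have hor : posProj (B j) = 1 ∨ posProj (B (j + 1)) = 1 := by
          rcases Nat.even_or_odd j with he | ho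
          · exact Or.inl (hpos j hj he)
          · exact Or.inr (hpos (j + 1) (by omega) ho.add_one)
        have h1 := re_inner_link_le (hB j) (hB (j + 1)) (A j) hor (u j) (u (j + 1))
        set p := ‖op (posSqrt (B j)) (u j)‖
        set q := ‖op (posSqrt (B (j + 1))) (u (j + 1))‖
        have h2 : ‖op (posInvSqrt (B j) * A j * posInvSqrt (B (j + 1)))‖ * p * q ≤
            γ j * p * q := by
          gcongr; exact hlink j hj
        have h3 := (abs_le.mp h1).1
        nlinarith [mul_nonneg (hγ j) (sq_nonneg (p - q))]
      · have := mul_nonneg (hγ j) (sq_nonneg ‖op (posSqrt (B (j + 1))) (u (j + 1))‖)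
        simpa [hj] using this) n
  -- Cauchy–Schwarz at each site and the inequality fg ≤ f²/(2t) + t g²/2, weighted so that half of
  -- the gain t‖u‖² survives.
  have hsum : ∑ j ∈ Finset.range (n + 1),
      (inner ℂ (shifted J t x j) (op (sgn (B j)) (u j))).re ≤
      ∑ j ∈ Finset.range (n + 1), (‖shifted J t x j‖ ^ 2 / (2 * t) + t / 2 * ‖u j‖ ^ 2) := by
    refine Finset.sum_le_sum fun j _ => ?_
    have h1 := (Complex.re_le_norm _).trans
      (norm_inner_le_norm (𝕜 := ℂ) (shifted J t x j) (op (sgn (B j)) (u j)))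
    rw [norm_op_sgn] at h1
    refine h1.trans ?_
    have h2 : ‖shifted J t x j‖ ^ 2 / (2 * t) + t / 2 * ‖u j‖ ^ 2 -
        ‖shifted J t x j‖ * ‖u j‖ = (‖shifted J t x j‖ - t * ‖u j‖) ^ 2 / (2 * t) := by
      field_simp
      ring
    have h3 : 0 ≤ (‖shifted J t x j‖ - t * ‖u j‖) ^ 2 / (2 * t) := by positivity
    linarith
  rw [Finset.sum_add_distrib, ← Finset.sum_div, ← Finset.mul_sum] at hsum
  have hWn := mul_nonneg (hγ n) (sq_nonneg ‖op (posSqrt (B n)) (u n)‖)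
  have hXn : (inner ℂ (op (A n) (u (n + 1))) (op (sgn (B n)) (u n))).re = 0 := by
    simp [hn (n + 1) (by omega)]
  rw [← norm_sq_eq_sum u fun j hj => hn j (by omega)] at hchain hsum
  have hF := sum_norm_sq_le (shifted J t x) (Finset.range (n + 1))
  have hF' : (∑ j ∈ Finset.range (n + 1), ‖shifted J t x j‖ ^ 2) / (2 * t) ≤
      ‖shifted J t x‖ ^ 2 / (2 * t) := by gcongr
  have hfinal : t / 2 * ‖u‖ ^ 2 ≤ ‖shifted J t x‖ ^ 2 / (2 * t) := by
    simp only [hXn] at hchain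
    linarith
  rw [le_div_iff₀ (by positivity)] at hfinal
  refine le_of_sq_le_sq ?_ (norm_nonneg _)
  nlinarith

theorem eventually_norm_le_of_limsup_enorm {E : Type*} [SeminormedAddCommGroup E] {f : ℕ → E}
    {c : ℝ} (h : limsup (fun n => ‖f n‖ₑ) atTop < ENNReal.ofReal c) :
    ∀ᶠ n in atTop, ‖f n‖ ≤ c := by
  filter_upwards [eventually_lt_of_limsup_lt h] with n hn
  rw [← ofReal_norm] at hn
  exact ((ENNReal.ofReal_lt_ofReal_iff_of_nonneg (norm_nonneg _)).mp hn).le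

/-- Extended nonnegative reals with sum less than one are less than reals with sum less than
one. -/
theorem exists_real_of_add_lt_one {α β : ℝ≥0∞} (h : α + β < 1) :
    ∃ a b : ℝ, 0 ≤ a ∧ 0 ≤ b ∧ a + b < 1 ∧ α < ENNReal.ofReal a ∧ β < ENNReal.ofReal b := by
  have hα : α ≠ ⊤ := ((le_self_add.trans_lt h).trans ENNReal.one_lt_top).ne
  have hβ : β ≠ ⊤ := ((le_add_self.trans_lt h).trans ENNReal.one_lt_top).ne
  have h' : α.toReal + β.toReal < 1 := by
    rw [← ENNReal.toReal_add hα hβ, ← ENNReal.toReal_one]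
    exact (ENNReal.toReal_lt_toReal (ENNReal.add_ne_top.mpr ⟨hα, hβ⟩) ENNReal.one_ne_top).mpr h
  have h0 : 0 ≤ α.toReal := ENNReal.toReal_nonneg
  have h1 : 0 ≤ β.toReal := ENNReal.toReal_nonneg
  -- Each bound takes a third of the slack, and the last third keeps the sum strictly below 1.
  refine ⟨α.toReal + (1 - α.toReal - β.toReal) / 3, β.toReal + (1 - α.toReal - β.toReal) / 3,
    by linarith, by linarith, by linarith, ?_, ?_⟩
  · exact (ENNReal.lt_ofReal_iff_toReal_lt hα).mpr (by linarith)
  · exact (ENNReal.lt_ofReal_iff_toReal_lt hβ).mpr (by linarith)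

end BlockJacobi

/-! ### Choice of constants and conclusion. -/

open BlockJacobi in
theorem theorem3p2 (d : ℕ) (hd : 1 ≤ d) (A B : ℕ → BlockJacobi.Mat d)
    (hA : ∀ n, IsUnit (A n)) (hB : ∀ n, (B n).IsHermitian)
    (h1 : BlockJacobi.TendsToInfty fun k => B (2 * k))
    (h2 : Tendsto (fun k => BlockJacobi.posInv (B (2 * k + 1))) atTop (𝓝 0))
    (h3 : limsup (fun n => ‖BlockJacobi.op (BlockJacobi.posInvSqrt (B (2 * n + 1)) *
              (A (2 * n))ᴴ * BlockJacobi.invSqrt (B (2 * n)))‖ₑ) atTop +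
          limsup (fun n => ‖BlockJacobi.op (BlockJacobi.posInvSqrt (B (2 * n + 1)) *
              A (2 * n + 1) * BlockJacobi.invSqrt (B (2 * n + 2)))‖ₑ) atTop < 1)
    (J : BlockJacobi.L2 d →ₗ.[ℂ] BlockJacobi.L2 d)
    (hJ : IsSelfAdjoint J) (hext : BlockJacobi.minimal A B ≤ J) :
    BlockJacobi.DiscreteSpectrumOn J (Set.Ioi 0) := by
  intro t ht hspec
  have ht' : 0 < t := ht
  have hfin := finiteDimensional_eigenspace A B hA hB hJ hext t
  obtain ⟨a, b, ha, hb, hab, hα, hβ⟩ := exists_real_of_add_lt_one h3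
  have hfa := eventually_norm_le_of_limsup_enorm hα
  have hgb := eventually_norm_le_of_limsup_enorm hβ
  -- With ρ = a + b, the threshold (1 - ρ)/(2t) for `posInv` at odd sites and its reciprocal for the
  -- spectrum at even sites both give 2t‖Ex‖² ≤ (1 - ρ)‖B₊^(1/2) x‖².
  have hε : 0 < (1 - (a + b)) / (2 * t) := div_pos (by linarith) (by linarith)
  have hM : 0 < 2 * t / (1 - (a + b)) := div_pos (by linarith) (by linarith)
  obtain ⟨K₁, hK₁⟩ := h1 (2 * t / (1 - (a + b))) hM.le
  obtain ⟨K₂, hK₂⟩ := eventually_atTop.mp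
    (hfa.and (hgb.and ((tendsto_norm_op h2).eventually (gt_mem_nhds hε))))
  have hspecB : ∀ k ≥ K₁, ∀ x ∈ spectrum ℝ (B (2 * k)), 2 * t / (1 - (a + b)) ≤ x :=
    fun k hk x hx => le_of_mem_spectrum (hK₁ k hk) hx
  have hspecPos : ∀ k ≥ K₁, ∀ x ∈ spectrum ℝ (B (2 * k)), 0 < x :=
    fun k hk x hx => hM.trans_le (hspecB k hk x hx)
  have hinv : ∀ k ≥ K₁, invSqrt (B (2 * k)) = posInvSqrt (B (2 * k)) :=
    fun k hk => invSqrt_eq_posInvSqrt (hB _) (hspecPos k hk)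
  have hbound : ∀ x ∈ finSuppFrom J (2 * max K₁ K₂), t * ‖(x : L2 d)‖ ≤ ‖shifted J t x‖ := by
    -- The link weights alternate between a and b, so the two links at any site use up exactly ρ.
    refine mul_norm_le_norm_shifted (ρ := a + b) A B hB hext ht' (fun j => if Even j then a else b)
      (fun j => by split_ifs <;> assumption)
      (fun j => by
        rcases Nat.even_or_odd j with hj | hj
        · simp [hj, Nat.even_add_one]
        · simp [Nat.even_add_one, Nat.not_even_iff_odd.mpr hj, add_comm])
      (2 * max K₁ K₂) ?_ ?_ ?_
    · intro j hj hev
      obtain ⟨k, rfl⟩ := hev.two_dvd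
      exact posProj_eq_one (hB _) (hspecPos k (by omega))
    · intro j hj x
      rcases Nat.even_or_odd' j with ⟨k, rfl | rfl⟩
      · have h := mul_norm_sq_posProj_le (hspecB k (by omega)) x
        rw [div_mul_eq_mul_div, div_le_iff₀ (by linarith)] at h
        linarith
      · have h := (norm_sq_posProj_le (hB (2 * k + 1)) x).trans
          (mul_le_mul_of_nonneg_right (hK₂ k (by omega)).2.2.le (sq_nonneg _))
        rw [div_mul_eq_mul_div, le_div_iff₀ (by linarith)] at h
        linarith
    · intro j hj
      rcases Nat.even_or_odd' j with ⟨k, rfl | rfl⟩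
      -- Here the even site is the left end, so the hypothesis bounds the adjoint of the required
      -- product.
      · have h := (hK₂ k (by omega)).1
        rw [hinv k (by omega), ← norm_op_conjTranspose] at h
        simpa [Matrix.conjTranspose_mul, conjTranspose_posInvSqrt, mul_assoc] using h
      · have h := (hK₂ k (by omega)).2.1
        rw [show 2 * k + 2 = 2 * (k + 1) by ring, hinv (k + 1) (by omega)] at h
        rw [show 2 * k + 1 + 1 = 2 * (k + 1) by ring, if_neg (by simp)]
        exact h
  have hsol := finiteDimensional_solutions A B hA t (2 * max K₁ K₂)
  have horth : FiniteDimensional ℂ ((finSuppFrom J (2 * max K₁ K₂)).map (shifted J t))ᗮ :=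
    Submodule.finiteDimensional_of_le (orthogonal_map_shifted_le A B hB hext t _)
  have hcl := isClosed_range_shifted hJ t ht' _ hbound
  obtain ⟨hiso, hne⟩ := isolated_of_isClosed_range hJ t hcl hspec
  exact ⟨hiso, hne, hfin⟩
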